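/- A tournament is a finite directed graph without loops that has exactly one arc between any two distinct vertices; it is strong if there is a directed path from every vertex to every other vertex. A maximal transitive subtournament of $T$ is an induced subtournament $T[W]$ whose arc relation is transitive (equivalently, which has no directed cycle) and whose vertex set $W$ is inclusion-maximal with this property. A minimal feedback vertex set of $T$ is an inclusion-minimal set $F$ of vertices such that $T$ with $F$ deleted has no directed cycle; the minimal feedback vertex sets are exactly the complements of the vertex sets of the maximal transitive subtournaments. Let $f(T)$ be the number of minimal feedback vertex sets of $T$, and for $n \ge 0$ let $M(n)$ be the maximum of $f(T)$ over all tournaments $T$ with $n$ vertices. Put $\beta = 1.6740$. Theorem. (a) Every strong tournament on $n$ vertices has at most $\beta^n$ maximal transitive subtournaments. (b) Every tournament $T$ on $n$ vertices, strong or not, satisfies $f(T) \le \beta^n$; that is, $M(n) \le \beta^n$ for all $n \ge 0$. -/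

import Mathlib

namespace TournamentFVS

/-- A digraph is a tournament if it has no loops and exactly one arc between any two distinct
vertices. -/
structure IsTournament {V : Type*} (T : Digraph V) : Prop where
  loopless : ∀ v, ¬ T.Adj v v
  one_arc : ∀ u v, u ≠ v → Xor (T.Adj u v) (T.Adj v u)

/-- A tournament is strong if there is a directed path from any vertex to any other one. -/
def IsStrong {V : Type*} (T : Digraph V) : Prop :=
  ∀ u v, Relation.ReflTransGen T.Adj u v

/-- The subdigraph `T[W]` induced by the vertex set `W`. -/
def induced {V : Type*} (T : Digraph V) (W : Set V) : Digraph W where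
  Adj a b := T.Adj a b

/-- A digraph is acyclic if no vertex lies on a directed closed walk of positive length. -/
def IsAcyclic {V : Type*} (T : Digraph V) : Prop :=
  ∀ v, ¬ Relation.TransGen T.Adj v v

/-- A digraph is transitive if its arc relation is transitive. -/
def IsTransitive {V : Type*} (T : Digraph V) : Prop :=
  ∀ u v w, T.Adj u v → T.Adj v w → T.Adj u w

/-- `F` is a feedback vertex set of `T` if deleting `F` leaves an acyclic digraph. -/
def IsFVS {V : Type*} (T : Digraph V) (F : Set V) : Prop :=
  IsAcyclic (induced T Fᶜ)

/-- A feedback vertex set that has no feedback vertex set as a proper subset. -/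
def IsMinimalFVS {V : Type*} (T : Digraph V) (F : Set V) : Prop :=
  Minimal (IsFVS T) F

/-- `T[W]` is a maximal transitive subtournament of `T` (with respect to vertex inclusion). -/
def IsMaximalTransitive {V : Type*} (T : Digraph V) (W : Set V) : Prop :=
  Maximal (fun U => IsTransitive (induced T U)) W

/-- The number of maximal transitive subtournaments of `T`. -/
noncomputable def numMaximalTransitive {V : Type*} (T : Digraph V) : ℕ :=
  {W : Set V | IsMaximalTransitive T W}.ncard

/-- `f(T)`, the number of minimal feedback vertex sets of `T`. -/
noncomputable def numMinimalFVS {V : Type*} (T : Digraph V) : ℕ :=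
  {F : Set V | IsMinimalFVS T F}.ncard

/-- `M(n)`, the maximum of `f(T)` over all tournaments `T` with `n` vertices. -/
noncomputable def maxNumMinimalFVS (n : ℕ) : ℕ :=
  sSup {k | ∃ T : Digraph (Fin n), IsTournament T ∧ numMinimalFVS T = k}

/-- The supremum in the definition of `M(n)` is an attained maximum. -/
theorem maxNumMinimalFVS_isGreatest (n : ℕ) :
    IsGreatest {k | ∃ T : Digraph (Fin n), IsTournament T ∧ numMinimalFVS T = k}
      (maxNumMinimalFVS n) := by
  have hne : {k | ∃ T : Digraph (Fin n), IsTournament T ∧ numMinimalFVS T = k}.Nonempty := by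
    refine ⟨_, ⟨fun a b => a < b⟩, ⟨fun v => lt_irrefl v, fun u v h => ?_⟩, rfl⟩
    rcases lt_or_gt_of_ne h with h | h
    · exact Or.inl ⟨h, h.asymm⟩
    · exact Or.inr ⟨h, h.asymm⟩
  have hbdd : BddAbove {k | ∃ T : Digraph (Fin n), IsTournament T ∧ numMinimalFVS T = k} := by
    refine ((Set.finite_range (fun T : Digraph (Fin n) => numMinimalFVS T)).subset ?_).bddAbove
    rintro k ⟨T, -, rfl⟩
    exact ⟨T, rfl⟩
  exact ⟨Nat.sSup_mem hne hbdd, fun k hk => le_csSup hbdd hk⟩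

/-- For tournaments, "transitive" and "acyclic" are the same. -/
theorem IsTournament.isAcyclic_induced_iff {V : Type*} {T : Digraph V} (hT : IsTournament T)
    (W : Set V) : IsAcyclic (induced T W) ↔ IsTransitive (induced T W) := by
  constructor
  · intro h u v w huv hvw
    by_cases huw : (u : V) = w
    · obtain rfl : u = w := Subtype.ext huw
      exact (h u (.tail (.single huv) hvw)).elim
    · rcases hT.one_arc u w huw with h' | h'
      · exact h'.1
      · exact (h u (.tail (.tail (.single huv) hvw) h'.1)).elim
  · intro h v hv
    have : IsTrans _ (induced T W).Adj := ⟨h⟩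
    rw [Relation.transGen_eq_self] at hv
    exact hT.loopless v hv

/-- The maximal transitive subtournaments are the complements of the minimal feedback vertex
sets. -/
theorem IsTournament.isMinimalFVS_compl_iff {V : Type*} {T : Digraph V} (hT : IsTournament T)
    (W : Set V) : IsMinimalFVS T Wᶜ ↔ IsMaximalTransitive T W := by
  have key : ∀ U : Set V, IsFVS T Uᶜ ↔ IsTransitive (induced T U) := fun U => by
    rw [IsFVS, compl_compl, hT.isAcyclic_induced_iff]
  constructor
  · intro h
    refine ⟨(key W).1 h.1, fun U hU hWU => ?_⟩
    exact Set.compl_subset_compl.1 (h.2 ((key U).2 hU) (Set.compl_subset_compl.2 hWU))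
  · intro h
    refine ⟨(key W).2 h.1, fun F hF hFW => ?_⟩
    have hF' : IsTransitive (induced T Fᶜ) := (key _).1 (by rwa [compl_compl])
    exact Set.compl_subset_comm.1 (h.2 hF' (Set.subset_compl_comm.1 hFW))

end TournamentFVS

namespace TournamentFVS

open Finset
open scoped Classical

variable {V : Type*} {T : Digraph V}

/-! Write β = 1.6740. The bound β^|A| on the number of maximal transitive sets `W` of `T[A]` is
proved by strong induction on `A`; complementation turns it into the bound for feedback vertex sets.

If all `W` in a class start, in their transitive order, with the same set `D`, then `W \ D`
determines `W` and is maximal transitive among the vertices dominated by `D`. If moreover the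
remainders avoid `i` given vertices, the class has at most β^(|A| - i) members (`count_le`). It
remains to split into classes with ∑ β^(-i) ≤ 1.

The split depends on a vertex `v` of minimum in-degree. In-degree 0: `v` lies in every `W`.
In-degree 1 or 2: split by which of `v` and its in-neighbours lie in `W`. If these in-neighbours
have small in-degrees, the traces of `W` on their in-neighbourhoods are enumerated; if large, having
such a vertex together with `v` in `W` excludes a whole in-neighbourhood. In-degree at least 3:
split by the source `s` of `W`; the required ∑ β^(-d(s)) ≤ β, with d(s) the in-degree, follows from
Landau's inequalities. -/

theorem IsTournament.asymm (hT : IsTournament T) {x y : V} (h : T.Adj x y) : ¬ T.Adj y x := by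
  intro h'
  by_cases hxy : x = y
  · subst hxy; exact hT.loopless _ h
  · rcases hT.one_arc x y hxy with h1 | h1
    · exact h1.2 h'
    · exact h1.2 h

theorem IsTournament.ne (hT : IsTournament T) {x y : V} (h : T.Adj x y) : x ≠ y := by
  rintro rfl; exact hT.loopless _ h

theorem IsTournament.total (hT : IsTournament T) {x y : V} (h : x ≠ y) :
    T.Adj x y ∨ T.Adj y x := by
  rcases hT.one_arc x y h with h1 | h1
  · exact Or.inl h1.1
  · exact Or.inr h1.1

/-! ### Maximal transitive sets and removal of a common prefix -/

/-- `W` spans no directed triangle of `T`. -/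
def NoTriangle (T : Digraph V) (W : Finset V) : Prop :=
  ∀ x ∈ W, ∀ y ∈ W, ∀ z ∈ W, ¬ (T.Adj x y ∧ T.Adj y z ∧ T.Adj z x)

theorem NoTriangle.mono {W U : Finset V} (h : NoTriangle T W) (hU : U ⊆ W) : NoTriangle T U :=
  fun x hx y hy z hz => h x (hU hx) y (hU hy) z (hU hz)

/-- The vertex sets of the maximal transitive subtournaments of `T[A]`. -/
noncomputable def mts (T : Digraph V) (A : Finset V) : Finset (Finset V) :=
  A.powerset.filter fun W => NoTriangle T W ∧ ∀ x ∈ A, x ∉ W → ¬ NoTriangle T (insert x W)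

theorem mem_mts {A W : Finset V} : W ∈ mts T A ↔
    W ⊆ A ∧ NoTriangle T W ∧ ∀ x ∈ A, x ∉ W → ¬ NoTriangle T (insert x W) := by
  simp [mts]

theorem exists_triangle_of_not_noTriangle_insert (hT : IsTournament T) {W : Finset V}
    (h : NoTriangle T W) {x : V} (hx : ¬ NoTriangle T (insert x W)) :
    ∃ y ∈ W, ∃ z ∈ W, T.Adj x y ∧ T.Adj y z ∧ T.Adj z x := by
  simp only [NoTriangle, not_forall, not_not] at hx
  obtain ⟨a, ha, b, hb, c, hc, hab, hbc, hca⟩ := hx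
  rw [mem_insert] at ha hb hc
  rcases ha with rfl | ha
  · exact ⟨b, hb.resolve_left (hT.ne hab).symm, c, hc.resolve_left (hT.ne hca), hab, hbc, hca⟩
  · rcases hb with rfl | hb
    · exact ⟨c, hc.resolve_left (hT.ne hbc).symm, a, ha, hbc, hca, hab⟩
    · rcases hc with rfl | hc
      · exact ⟨a, ha, b, hb, hca, hab, hbc⟩
      · exact absurd ⟨hab, hbc, hca⟩ (h a ha b hb c hc)

theorem exists_triangle_of_mem_mts (hT : IsTournament T) {A W : Finset V} (hW : W ∈ mts T A)
    {x : V} (hxA : x ∈ A) (hx : x ∉ W) :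
    ∃ y ∈ W, ∃ z ∈ W, T.Adj x y ∧ T.Adj y z ∧ T.Adj z x :=
  exists_triangle_of_not_noTriangle_insert hT (mem_mts.1 hW).2.1 ((mem_mts.1 hW).2.2 x hxA hx)

/-- Maximal transitive subtournaments with a common prefix `D` whose remainders lie in a set `B`
dominated by `D` are determined by maximal transitive subtournaments of `T[B]`. -/
theorem card_le_card_mts (hT : IsTournament T) {A B D : Finset V} {F : Finset (Finset V)}
    (hF : F ⊆ mts T A) (hBA : B ⊆ A) (hDB : ∀ d ∈ D, ∀ b ∈ B, T.Adj d b)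
    (hD : ∀ W ∈ F, D ⊆ W) (hB : ∀ W ∈ F, W \ D ⊆ B) : F.card ≤ (mts T B).card := by
  refine card_le_card_of_injOn (fun W => W \ D) (fun W hW => ?_) (fun W hW U hU h => ?_)
  · have hW' := hF hW
    refine mem_mts.2 ⟨hB W hW, (mem_mts.1 hW').2.1.mono sdiff_subset, fun x hx hxW hno => ?_⟩
    have hxD : x ∉ D := fun h => hT.loopless x (hDB x h x hx)
    have hxW' : x ∉ W := fun h => hxW (mem_sdiff.2 ⟨h, hxD⟩)
    obtain ⟨y, hy, z, hz, hxy, hyz, hzx⟩ := exists_triangle_of_mem_mts hT hW' (hBA hx) hxW'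
    -- No arc goes from `B` to `D`, so a triangle through `x ∈ B` cannot meet `D`.
    have hyD : y ∈ W \ D := mem_sdiff.2 ⟨hy, fun h => hT.asymm hxy (hDB y h x hx)⟩
    have hzD : z ∈ W \ D := mem_sdiff.2 ⟨hz, fun h => hT.asymm hyz (hDB z h y (hB W hW hyD))⟩
    exact hno x (mem_insert_self _ _) y (mem_insert_of_mem hyD) z (mem_insert_of_mem hzD)
      ⟨hxy, hyz, hzx⟩
  · simp only at h
    rw [← union_sdiff_of_subset (hD W hW), ← union_sdiff_of_subset (hD U hU), h]

/-! ### Counting by classes -/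

/-- The number of maximal transitive subtournaments of `T[A]` with the property `p`. -/
noncomputable def count (T : Digraph V) (A : Finset V) (p : Finset V → Prop) : ℝ :=
  (((mts T A).filter p).card : ℝ)

theorem count_le_add {A : Finset V} {p q r : Finset V → Prop}
    (h : ∀ W ∈ mts T A, p W → q W ∨ r W) : count T A p ≤ count T A q + count T A r := by
  unfold count
  norm_cast
  refine (card_le_card fun W hW => ?_).trans (card_union_le _ _)
  rw [mem_filter] at hW
  rw [mem_union, mem_filter, mem_filter]
  exact (h W hW.1 hW.2).imp (fun h => ⟨hW.1, h⟩) (fun h => ⟨hW.1, h⟩)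

theorem count_mono {A : Finset V} {p q : Finset V → Prop}
    (h : ∀ W ∈ mts T A, p W → q W) : count T A p ≤ count T A q := by
  unfold count
  norm_cast
  refine card_le_card fun W hW => ?_
  rw [mem_filter] at hW ⊢
  exact ⟨hW.1, h W hW.1 hW.2⟩

theorem count_le_sum {ι : Type*} {A : Finset V} {p : Finset V → Prop} (s : Finset ι)
    (q : ι → Finset V → Prop) (h : ∀ W ∈ mts T A, p W → ∃ i ∈ s, q i W) :
    count T A p ≤ ∑ i ∈ s, count T A (q i) := by
  unfold count
  norm_cast
  refine (card_le_card (t := s.biUnion fun i => (mts T A).filter (q i)) fun W hW => ?_).trans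
    card_biUnion_le
  rw [mem_filter] at hW
  obtain ⟨i, hi, hq⟩ := h W hW.1 hW.2
  exact mem_biUnion.2 ⟨i, hi, mem_filter.2 ⟨hW.1, hq⟩⟩

/-- A count split according to the trace on `X`, which is known to lie in `S`. -/
theorem count_le_card_mul {A X : Finset V} {p : Finset V → Prop} (S : Finset (Finset V)) {M : ℝ}
    (hS : ∀ W ∈ mts T A, p W → W ∩ X ∈ S)
    (hM : ∀ Y ∈ S, count T A (fun W => p W ∧ W ∩ X = Y) ≤ M) :
    count T A p ≤ S.card * M := by
  refine (count_le_sum S (fun Y W => p W ∧ W ∩ X = Y)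
    fun W hW hp => ⟨_, hS W hW hp, hp, rfl⟩).trans ?_
  simpa using sum_le_card_nsmul S _ M hM

/-- The bound `(1.6740) ^ |B|` for all proper subsets `B` of `A`. -/
def BoundBelow (T : Digraph V) (A : Finset V) : Prop :=
  ∀ B ⊂ A, ((mts T B).card : ℝ) ≤ (1.6740 : ℝ) ^ B.card

/-- The members of a family have the common prefix `D`, and their remainders avoid `C`. -/
theorem count_le (hT : IsTournament T) {A : Finset V} (hA : BoundBelow T A) (D C : Finset V)
    (i : ℕ) (hi : 0 < i) (hC : C ⊆ A) (hCi : i ≤ C.card) {p : Finset V → Prop}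
    (hp : ∀ W ∈ mts T A, p W →
      D ⊆ W ∧ ∀ w ∈ W, w ∉ D → (∀ d ∈ D, T.Adj d w) ∧ w ∉ C) :
    count T A p ≤ (1.6740 : ℝ) ^ A.card * (1.6740⁻¹ : ℝ) ^ i := by
  set B := (A \ C).filter fun w => ∀ d ∈ D, T.Adj d w
  have hBC : B ⊆ A \ C := filter_subset _ _
  have hBcard : B.card + i ≤ A.card := by
    have h1 := card_le_card hBC
    have h2 := card_sdiff_add_card_eq_card hC
    omega
  have hBA : B ⊆ A := hBC.trans sdiff_subset
  have h1 : ((mts T A).filter p).card ≤ (mts T B).card := by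
    refine card_le_card_mts (D := D) hT (filter_subset _ _) hBA
      (fun d hd b hb => (mem_filter.1 hb).2 d hd) (fun W hW => ?_) (fun W hW w hw => ?_)
    · rw [mem_filter] at hW
      exact (hp W hW.1 hW.2).1
    · rw [mem_filter] at hW
      rw [mem_sdiff] at hw
      have h := (hp W hW.1 hW.2).2 w hw.1 hw.2
      exact mem_filter.2 ⟨mem_sdiff.2 ⟨(mem_mts.1 hW.1).1 hw.1, h.2⟩, h.1⟩
  -- Since `0 < i`, the set `B` is a proper subset and the induction hypothesis applies.
  have h2 := hA B ⟨hBA, fun h => by have := card_le_card h; omega⟩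
  have h3 : (1.6740 : ℝ) ^ (B.card + i) ≤ 1.6740 ^ A.card :=
    pow_le_pow_right₀ (by norm_num) hBcard
  have h4 : (1.6740 : ℝ) ^ B.card ≤ (1.6740 : ℝ) ^ A.card * (1.6740⁻¹ : ℝ) ^ i := by
    rw [inv_pow, ← div_eq_mul_inv, le_div_iff₀ (by positivity), ← pow_add]
    exact h3
  refine le_trans ?_ h4
  refine le_trans ?_ h2
  unfold count
  exact_mod_cast h1

/-! ### In-neighbourhoods, sources and Landau's inequalities -/

/-- The in-neighbours of `v` in `A`. -/
noncomputable def inNbrs (T : Digraph V) (A : Finset V) (v : V) : Finset V :=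
  A.filter fun w => T.Adj w v

theorem mem_inNbrs {A : Finset V} {v w : V} : w ∈ inNbrs T A v ↔ w ∈ A ∧ T.Adj w v := by
  simp [inNbrs]

theorem inNbrs_subset {A : Finset V} {v : V} : inNbrs T A v ⊆ A := filter_subset _ _

/-- Every finite transitive tournament has a source. -/
theorem NoTriangle.exists_source (hT : IsTournament T) {W : Finset V} (h : NoTriangle T W)
    (hne : W.Nonempty) : ∃ s ∈ W, ∀ w ∈ W, w ≠ s → T.Adj s w := by
  obtain ⟨s, hs, hmin⟩ := exists_min_image W (fun s => (inNbrs T W s).card) hne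
  refine ⟨s, hs, fun w hw hws => ?_⟩
  by_contra hsw
  have hws' : T.Adj w s := (hT.total hws).resolve_right hsw
  have : inNbrs T W w ⊂ inNbrs T W s := by
    refine ⟨fun z hz => ?_, fun hsub => ?_⟩
    · rw [mem_inNbrs] at hz ⊢
      refine ⟨hz.1, ?_⟩
      by_contra hzs
      have hne : z ≠ s := by rintro rfl; exact hT.asymm hws' hz.2
      exact h s hs z hz.1 w hw ⟨(hT.total hne).resolve_left hzs, hz.2, hws'⟩
    · exact hT.loopless w (mem_inNbrs.1 (hsub (mem_inNbrs.2 ⟨hw, hws'⟩))).2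
  exact absurd (hmin w hw) (not_le.2 (card_lt_card this))

theorem count_true {A : Finset V} : count T A (fun _ => True) = (mts T A).card := by
  simp [count]

/-- A vertex without in-neighbours belongs to all maximal transitive subtournaments. -/
theorem card_mts_le_of_inNbrs_eq_empty (hT : IsTournament T) {A : Finset V}
    (hA : BoundBelow T A) {v : V} (hv : v ∈ A) (h : inNbrs T A v = ∅) :
    ((mts T A).card : ℝ) ≤ (1.6740 : ℝ) ^ A.card := by
  have hdom : ∀ w ∈ A, w ≠ v → T.Adj v w := fun w hw hwv =>
    (hT.total hwv).resolve_left fun h' => by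
      have : w ∈ inNbrs T A v := mem_inNbrs.2 ⟨hw, h'⟩
      simp [h] at this
  have key := count_le hT hA {v} {v} 1 one_pos (by simpa using hv) (by simp)
    (p := fun _ => True) fun W hW _ => by
      refine ⟨?_, fun w hw hwv => ?_⟩
      · rw [singleton_subset_iff]
        by_contra hvW
        obtain ⟨y, hy, z, hz, -, -, hzv⟩ := exists_triangle_of_mem_mts hT hW hv hvW
        have hzA := (mem_mts.1 hW).1 hz
        exact hT.asymm hzv (hdom z hzA (hT.ne hzv))
      · simp only [mem_singleton] at hwv
        simpa [hwv] using hdom w ((mem_mts.1 hW).1 hw) hwv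
  rw [count_true] at key
  refine key.trans (mul_le_of_le_one_right (by positivity) (by norm_num))

theorem sum_card_inNbrs (hT : IsTournament T) (B : Finset V) :
    2 * ∑ v ∈ B, (inNbrs T B v).card = B.card * (B.card - 1) := by
  induction B using Finset.induction_on with
  | empty => simp
  | insert x B hx ih =>
    have h1 : ∀ v ∈ B, (inNbrs T (insert x B) v).card =
        (inNbrs T B v).card + if T.Adj x v then 1 else 0 := by
      intro v hv
      unfold inNbrs
      rw [filter_insert]
      split_ifs with h
      · rw [card_insert_of_notMem (by simp [hx])]
      · rfl
    have h2 : (inNbrs T (insert x B) x).card = ∑ v ∈ B, if T.Adj v x then 1 else 0 := by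
      unfold inNbrs
      rw [filter_insert, if_neg (hT.loopless x), card_filter]
    rw [sum_insert hx, sum_congr rfl h1, sum_add_distrib, h2, card_insert_of_notMem hx]
    have h3 : (∑ v ∈ B, if T.Adj v x then 1 else 0) + (∑ v ∈ B, if T.Adj x v then 1 else 0)
        = B.card := by
      rw [← sum_add_distrib, card_eq_sum_ones]
      refine sum_congr rfl fun v hv => ?_
      have hne : v ≠ x := by rintro rfl; exact hx hv
      rcases hT.total hne with h | h
      · simp [h, hT.asymm h]
      · simp [h, hT.asymm h]
    have h4 : (B.card + 1) * (B.card + 1 - 1) = B.card * (B.card - 1) + 2 * B.card := by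
      rcases B.card with _ | m
      · rfl
      · simp only [Nat.add_sub_cancel]; ring
    rw [h4, ← ih, ← h3]
    ring

/-- Landau's condition on the in-degrees. -/
theorem two_mul_sum_sub_card_inNbrs_le (hT : IsTournament T) (A : Finset V) (t : ℕ) :
    2 * ∑ v ∈ A, (t - (inNbrs T A v).card) ≤ t * (t + 1) := by
  set B := A.filter fun v => (inNbrs T A v).card < t
  have h1 : ∑ v ∈ A, (t - (inNbrs T A v).card) = ∑ v ∈ B, (t - (inNbrs T A v).card) := by
    refine (sum_subset (filter_subset _ _) fun v hv hvB => ?_).symm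
    have : ¬ (inNbrs T A v).card < t := fun h => hvB (mem_filter.2 ⟨hv, h⟩)
    omega
  have h2 : ∑ v ∈ B, (t - (inNbrs T A v).card) + ∑ v ∈ B, (inNbrs T B v).card ≤ B.card * t := by
    rw [← sum_add_distrib, ← smul_eq_mul]
    refine sum_le_card_nsmul _ _ _ fun v hv => ?_
    have h3 : (inNbrs T B v).card ≤ (inNbrs T A v).card :=
      card_le_card (filter_subset_filter _ (filter_subset _ _))
    have h4 := (mem_filter.1 hv).2
    omega
  have h5 := sum_card_inNbrs hT B
  rw [h1]
  generalize ∑ v ∈ B, (t - (inNbrs T A v).card) = s at *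
  generalize ∑ v ∈ B, (inNbrs T B v).card = r at *
  generalize B.card = b at *
  rcases b with _ | b
  · simp at h2; simp [h2]
  · simp only [Nat.add_sub_cancel] at h5
    zify at *
    -- With `b + 1` vertices of in-degree below `t`, the slack is at least `(t - b) * (t - b - 1)`,
    -- which is non-negative at integers.
    rcases lt_or_ge (t : ℤ) (b + 1) with h | h
    · nlinarith
    · nlinarith

/-- Truncated subtraction makes `t + 1 - c` a ramp. Writing `x ^ c` as a non-negative combination of
ramps lets Landau's inequalities be applied term by term to a sum of powers. -/
theorem hasSum_geometric_ramp {x : ℝ} (h0 : 0 ≤ x) (h1 : x < 1) (c : ℕ) :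
    HasSum (fun t : ℕ => x ^ t * (1 - x) ^ 2 * ((t + 1 - c : ℕ) : ℝ)) (x ^ c) := by
  have hx : ‖x‖ < 1 := by rwa [Real.norm_of_nonneg h0]
  have h1x : (1 - x) ≠ 0 := by linarith
  have e1 : HasSum (fun t : ℕ => x ^ t * (1 - x) ^ 2 * ((t + 1 : ℕ) : ℝ)) 1 := by
    have := hasSum_choose_mul_geometric_of_norm_lt_one 1 hx
    have hf : (fun t : ℕ => x ^ t * (1 - x) ^ 2 * ((t + 1 : ℕ) : ℝ)) =
        fun t => ((t + 1).choose 1 : ℝ) * x ^ t * (1 - x) ^ 2 := by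
      funext t
      rw [Nat.choose_one_right]; ring
    have hv : (1 : ℝ) = 1 / (1 - x) ^ (1 + 1) * (1 - x) ^ 2 := by field_simp
    rw [hf]
    have e := this.mul_right ((1 - x) ^ 2)
    rwa [← hv] at e
  rw [← hasSum_nat_add_iff' c]
  have h0 : ∑ i ∈ range c, x ^ i * (1 - x) ^ 2 * ((i + 1 - c : ℕ) : ℝ) = 0 := by
    refine sum_eq_zero fun i hi => ?_
    have : i + 1 - c = 0 := by have := mem_range.1 hi; omega
    simp [this]
  rw [h0, sub_zero]
  have := e1.mul_left (x ^ c)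
  rw [mul_one] at this
  have hf : (fun t : ℕ => x ^ (t + c) * (1 - x) ^ 2 * ((t + c + 1 - c : ℕ) : ℝ)) =
      fun t => x ^ c * (x ^ t * (1 - x) ^ 2 * ((t + 1 : ℕ) : ℝ)) := by
    funext t
    have : t + c + 1 - c = t + 1 := by omega
    rw [this]
    ring
  rw [hf]
  exact this

/-- Summing ramps, `L t` is at most `(t + 2).choose 2` by Landau, but this alone is too weak. The
minimum in-degree 3 improves it to `7 * (t - 2)` for `t ≤ 6`. The resulting bound is the power sum
of the scores 3 (seven times), 7, 8, 9, …. -/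
theorem sum_pow_card_inNbrs_le (hT : IsTournament T) {A : Finset V}
    (h : ∀ v ∈ A, 3 ≤ (inNbrs T A v).card) :
    ∑ v ∈ A, (1.6740⁻¹ : ℝ) ^ (inNbrs T A v).card ≤ 1.6740 := by
  set x : ℝ := 1.6740⁻¹ with hx
  have hx0 : 0 ≤ x := by rw [hx]; norm_num
  have hx1 : x < 1 := by rw [hx]; norm_num
  set L : ℕ → ℕ := fun t => ∑ v ∈ A, (t + 1 - (inNbrs T A v).card) with hL
  have hS : HasSum (fun t => x ^ t * (1 - x) ^ 2 * (L t : ℝ))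
      (∑ v ∈ A, x ^ (inNbrs T A v).card) := by
    have := hasSum_sum fun v (_ : v ∈ A) => hasSum_geometric_ramp hx0 hx1 (inNbrs T A v).card
    have hf : (fun t : ℕ => x ^ t * (1 - x) ^ 2 * (L t : ℝ)) = fun t => ∑ v ∈ A,
        x ^ t * (1 - x) ^ 2 * ((t + 1 - (inNbrs T A v).card : ℕ) : ℝ) := by
      funext t
      rw [hL, Nat.cast_sum, mul_sum]
    rw [hf]
    exact this
  have hG : HasSum (fun t => x ^ t * (1 - x) ^ 2 * ((t + 2).choose 2 : ℝ)) (1 - x)⁻¹ := by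
    have hn : ‖x‖ < 1 := by rwa [Real.norm_of_nonneg hx0]
    have h1x : (1 - x) ≠ 0 := by linarith
    have hf : (fun t : ℕ => x ^ t * (1 - x) ^ 2 * ((t + 2).choose 2 : ℝ)) =
        fun t => ((t + 2).choose 2 : ℝ) * x ^ t * (1 - x) ^ 2 := by
      funext t; ring
    have hv : (1 - x)⁻¹ = 1 / (1 - x) ^ (2 + 1) * (1 - x) ^ 2 := by field_simp
    rw [hf, hv]
    exact (hasSum_choose_mul_geometric_of_norm_lt_one 2 hn).mul_right ((1 - x) ^ 2)
  have hLle : ∀ t, L t ≤ (t + 2).choose 2 := fun t => by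
    have := two_mul_sum_sub_card_inNbrs_le hT A (t + 1)
    rw [Nat.choose_two_right, Nat.le_div_iff_mul_le two_pos]
    simp only [hL]
    rw [show t + 2 - 1 = t + 1 by omega]
    linarith
  -- For `c ≥ 3` the ramp is convex in `t` and vanishes for `t ≤ 2`, so it lies below its chord from
  -- 2 to 6.
  have hlin : ∀ t, t ≤ 6 → 4 * L t ≤ (t - 2) * L 6 := fun t ht => by
    simp only [hL, mul_sum]
    refine sum_le_sum fun v hv => ?_
    have := h v hv
    generalize (inNbrs T A v).card = c at *
    rcases le_or_gt (t + 1) c with hc | hc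
    · have : t + 1 - c = 0 := by omega
      simp [this]
    · interval_cases t <;> interval_cases c <;> simp
  have h6 : L 6 ≤ 28 := hLle 6
  have hlin' : ∀ t, t ≤ 6 → (L t : ℝ) ≤ 7 * ((t - 2 : ℕ) : ℝ) := fun t ht => by
    have h1 := hlin t ht
    have h2 : (t - 2) * L 6 ≤ (t - 2) * 28 := Nat.mul_le_mul_left _ h6
    have : L t ≤ 7 * (t - 2) := by omega
    exact_mod_cast this
  have key : ∑ v ∈ A, x ^ (inNbrs T A v).card -
      ∑ t ∈ range 7, x ^ t * (1 - x) ^ 2 * (L t : ℝ) ≤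
      (1 - x)⁻¹ - ∑ t ∈ range 7, x ^ t * (1 - x) ^ 2 * ((t + 2).choose 2 : ℝ) :=
    hasSum_le (fun t => mul_le_mul_of_nonneg_left
    (Nat.cast_le (α := ℝ).2 (hLle (t + 7))) (by positivity : 0 ≤ x ^ (t + 7) * (1 - x) ^ 2))
    ((hasSum_nat_add_iff' 7).2 hS) ((hasSum_nat_add_iff' 7).2 hG)
  have hsmall : ∑ t ∈ range 7, x ^ t * (1 - x) ^ 2 * (L t : ℝ) ≤
      ∑ t ∈ range 7, x ^ t * (1 - x) ^ 2 * (7 * ((t - 2 : ℕ) : ℝ)) :=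
    sum_le_sum fun t ht => mul_le_mul_of_nonneg_left
      (hlin' t (by have := mem_range.1 ht; omega)) (by positivity)
  have hnum : (1 - x)⁻¹ - ∑ t ∈ range 7, x ^ t * (1 - x) ^ 2 * ((t + 2).choose 2 : ℝ) +
      ∑ t ∈ range 7, x ^ t * (1 - x) ^ 2 * (7 * ((t - 2 : ℕ) : ℝ)) ≤ 1.6740 := by
    simp only [sum_range_succ, sum_range_zero, Nat.choose_two_right, hx]
    norm_num
  exact (sub_le_iff_le_add.1 key).trans ((add_le_add le_rfl hsmall).trans hnum)

/-- The bound by summing over the sources, when all in-degrees are at least `3`. -/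
theorem card_mts_le_of_three_le (hT : IsTournament T) {A : Finset V} (hA : BoundBelow T A)
    (hne : A.Nonempty) (h : ∀ v ∈ A, 3 ≤ (inNbrs T A v).card) :
    ((mts T A).card : ℝ) ≤ (1.6740 : ℝ) ^ A.card := by
  have h1 : count T A (fun _ => True) ≤ ∑ s ∈ A, count T A fun W =>
      s ∈ W ∧ ∀ w ∈ W, w ≠ s → T.Adj s w := by
    refine count_le_sum _ _ fun W hW _ => ?_
    rw [mem_mts] at hW
    have hWne : W.Nonempty := by
      rw [nonempty_iff_ne_empty]
      rintro rfl
      obtain ⟨a, ha⟩ := hne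
      refine hW.2.2 a ha (notMem_empty a) fun x hx y hy z hz hc => ?_
      simp only [insert_empty_eq, mem_singleton] at hx hy
      subst hx; subst hy
      exact hT.loopless _ hc.1
    obtain ⟨s, hs, hdom⟩ := hW.2.1.exists_source hT hWne
    exact ⟨s, hW.1 hs, hs, hdom⟩
  have h2 : ∀ s ∈ A, count T A (fun W => s ∈ W ∧ ∀ w ∈ W, w ≠ s → T.Adj s w) ≤
      (1.6740 : ℝ) ^ A.card * 1.6740⁻¹ * (1.6740⁻¹ : ℝ) ^ (inNbrs T A s).card := fun s hs => by
    have hs' : s ∉ inNbrs T A s := fun h => hT.loopless s (mem_inNbrs.1 h).2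
    have := count_le hT hA {s} (insert s (inNbrs T A s)) ((inNbrs T A s).card + 1)
      (Nat.succ_pos _) (insert_subset hs inNbrs_subset) (card_insert_of_notMem hs').ge
      (p := fun W => s ∈ W ∧ ∀ w ∈ W, w ≠ s → T.Adj s w) fun W hW hp => by
        refine ⟨singleton_subset_iff.2 hp.1, fun w hw hws => ?_⟩
        rw [mem_singleton] at hws
        have := hp.2 w hw hws
        refine ⟨by simpa using this, fun h => ?_⟩
        rcases mem_insert.1 h with h | h
        · exact hws h
        · exact hT.asymm this (mem_inNbrs.1 h).2
    rwa [pow_succ', ← mul_assoc] at this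
  rw [count_true] at h1
  refine (h1.trans (sum_le_sum h2)).trans ?_
  rw [← mul_sum]
  have h3 := sum_pow_card_inNbrs_le hT h
  calc _ ≤ (1.6740 : ℝ) ^ A.card * 1.6740⁻¹ * 1.6740 :=
        mul_le_mul_of_nonneg_left h3 (by positivity)
    _ = _ := by rw [mul_assoc, inv_mul_cancel₀ (by norm_num), mul_one]

/-! ### Minimum in-degree one -/

/-- A triangle `v → y → z → v` excluding `v` would have `z = u`, hence `y ∈ W ∩ X`. -/
theorem mem_mts_of_inter_eq_empty (hT : IsTournament T) {A X W : Finset V} {u v : V}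
    (hW : W ∈ mts T A) (hv : v ∈ A) (hI : ∀ w ∈ W, T.Adj w v → w = u)
    (hu : ∀ w ∈ W, T.Adj w u → w ∈ X) (hX : W ∩ X = ∅) : v ∈ W := by
  by_contra hvW
  obtain ⟨y, hy, z, hz, -, hyz, hzv⟩ := exists_triangle_of_mem_mts hT hW hv hvW
  have hzu := hI z hz hzv
  subst hzu
  have := mem_inter.2 ⟨hy, hu y hy hyz⟩
  simp [hX] at this

/-- The members containing `u` with a fixed trace `S` on the in-neighbours of `u`. -/
theorem count_trace_le (hT : IsTournament T) {A : Finset V} (hA : BoundBelow T A) {u : V}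
    (S C : Finset V) (i : ℕ) (hi : 0 < i) (hC : C ⊆ A) (hCi : i ≤ C.card)
    {p : Finset V → Prop}
    (hp : ∀ W ∈ mts T A, p W → u ∈ W ∧ W ∩ inNbrs T A u = S ∧
      ∀ w ∈ W, T.Adj u w → (∀ s ∈ S, T.Adj s w) → w ∉ C) :
    count T A p ≤ (1.6740 : ℝ) ^ A.card * (1.6740⁻¹ : ℝ) ^ i := by
  refine count_le hT hA (insert u S) C i hi hC hCi fun W hW hpW => ?_
  obtain ⟨huW, hS, hwC⟩ := hp W hW hpW
  have hWA := (mem_mts.1 hW).1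
  refine ⟨insert_subset huW (hS ▸ inter_subset_left), fun w hw hwD => ?_⟩
  rw [mem_insert, not_or] at hwD
  have huw : T.Adj u w := (hT.total hwD.1).resolve_left fun h =>
    hwD.2 (hS ▸ mem_inter.2 ⟨hw, mem_inNbrs.2 ⟨hWA hw, h⟩⟩)
  -- An arc `w → s` would close the triangle `u → w → s → u`; so `insert u S` is an initial segment
  -- of `W`.
  have hsw : ∀ s ∈ S, T.Adj s w := fun s hs => by
    have hne : s ≠ w := by rintro rfl; exact hwD.2 hs
    rw [← hS, mem_inter, mem_inNbrs] at hs
    exact (hT.total hne).resolve_right fun h =>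
      (mem_mts.1 hW).2.1 u huW w hw s hs.1 ⟨huw, h, hs.2.2⟩
  refine ⟨fun d hd => ?_, hwC w hw huw hsw⟩
  rcases mem_insert.1 hd with rfl | hd
  · exact huw
  · exact hsw d hd

theorem count_notMem_le (hT : IsTournament T) {A : Finset V} (hA : BoundBelow T A) {v : V}
    (hv : v ∈ A) : count T A (fun W => v ∉ W) ≤
      (1.6740 : ℝ) ^ A.card * (1.6740⁻¹ : ℝ) ^ 1 := by
  refine count_le hT hA ∅ {v} 1 one_pos (singleton_subset_iff.2 hv) (by simp)
    fun W hW hp => ⟨by simp, fun w hw _ => ⟨by simp, ?_⟩⟩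
  rw [mem_singleton]
  rintro rfl
  exact hp hw

/-- If `u ∉ W`, then `v` is the source. If `u ∈ W`, every trace on `P` costs `P.card + 2`: an empty
trace forces `v` in, while any `s` in the trace is beaten by `v`, so `v` cannot follow. For `P.card
≥ 4` there are too many traces; splitting on `v` first helps, as `u, v ∈ W` leaves only the empty
trace. -/
theorem card_mts_le_of_inNbrs_eq_singleton (hT : IsTournament T) {A : Finset V}
    (hA : BoundBelow T A) {u v : V} (hv : v ∈ A) (h : inNbrs T A v = {u})
    (hu : 1 ≤ (inNbrs T A u).card) :
    ((mts T A).card : ℝ) ≤ (1.6740 : ℝ) ^ A.card := by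
  have huv' : u ∈ inNbrs T A v := by simp [h]
  obtain ⟨huA, huv⟩ := mem_inNbrs.1 huv'
  have hIv : ∀ w ∈ A, T.Adj w v → w = u := fun w hw hwv => by
    simpa [h] using mem_inNbrs.2 ⟨hw, hwv⟩
  have hdom : ∀ w ∈ A, w ≠ v → w ≠ u → T.Adj v w := fun w hw hwv hwu =>
    (hT.total hwv).resolve_left fun h' => hwu (hIv w hw h')
  set P := inNbrs T A u with hP
  have huP : u ∉ P := fun h => hT.loopless u (mem_inNbrs.1 h).2
  have hvP : v ∉ P := fun h => hT.asymm huv (mem_inNbrs.1 h).2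
  have hvuP : v ∉ insert u P := by simp [hvP, (hT.ne huv).symm]
  have hCA : insert v (insert u P) ⊆ A := insert_subset hv (insert_subset huA inNbrs_subset)
  have hCc : (insert v (insert u P)).card = P.card + 2 := by
    rw [card_insert_of_notMem hvuP, card_insert_of_notMem huP]
  have c1 : count T A (fun W => u ∉ W) ≤ (1.6740 : ℝ) ^ A.card * (1.6740⁻¹ : ℝ) ^ 2 := by
    refine count_le hT hA {v} {u, v} 2 two_pos
      (insert_subset huA (singleton_subset_iff.2 hv)) (card_pair (hT.ne huv)).ge
      fun W hW huW => ?_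
    have hWA := (mem_mts.1 hW).1
    refine ⟨singleton_subset_iff.2 ?_, fun w hw hwv => ?_⟩
    · by_contra hvW
      obtain ⟨y, hy, z, hz, -, -, hzv⟩ := exists_triangle_of_mem_mts hT hW hv hvW
      exact huW (hIv z (hWA hz) hzv ▸ hz)
    · rw [mem_singleton] at hwv
      have hwu : w ≠ u := by rintro rfl; exact huW hw
      simp [hwv, hwu, hdom w (hWA hw) hwv hwu]
  have c2 : ∀ S ∈ P.powerset, count T A (fun W => u ∈ W ∧ W ∩ P = S) ≤
      (1.6740 : ℝ) ^ A.card * (1.6740⁻¹ : ℝ) ^ (P.card + 2) := fun S hS => by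
    have hSP := mem_powerset.1 hS
    rcases S.eq_empty_or_nonempty with rfl | ⟨s, hs⟩
    · refine count_le hT hA {u, v} (insert v (insert u P)) (P.card + 2) (Nat.succ_pos _) hCA hCc.ge
        fun W hW hp => ?_
      have hWA := (mem_mts.1 hW).1
      have hvW : v ∈ W := mem_mts_of_inter_eq_empty hT hW hv (fun w hw => hIv w (hWA hw))
        (fun w hw hwu => mem_inNbrs.2 ⟨hWA hw, hwu⟩) hp.2
      refine ⟨insert_subset hp.1 (singleton_subset_iff.2 hvW), fun w hw hwD => ?_⟩
      simp only [mem_insert, mem_singleton, not_or] at hwD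
      have hwP : w ∉ P := fun h => by
        have := mem_inter.2 ⟨hw, h⟩
        simp [hp.2] at this
      have huw : T.Adj u w := (hT.total hwD.1).resolve_left fun h =>
        hwP (mem_inNbrs.2 ⟨hWA hw, h⟩)
      simp [hwD.1, hwD.2, hwP, huw, hdom w (hWA hw) hwD.2 hwD.1]
    · refine count_trace_le hT hA (u := u) S _ (P.card + 2) (Nat.succ_pos _) hCA hCc.ge
        fun W hW hp => ⟨hp.1, hp.2, fun w hw huw hsw hwC => ?_⟩
      rcases mem_insert.1 hwC with rfl | hwC
      · have hsP := mem_inNbrs.1 (hSP hs)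
        exact huP (hIv s hsP.1 (hsw s hs) ▸ hSP hs)
      · rcases mem_insert.1 hwC with rfl | hwC
        · exact hT.loopless _ huw
        · exact hT.asymm huw (mem_inNbrs.1 hwC).2
  rw [← count_true]
  rcases lt_or_ge P.card 4 with hP4 | hP4
  · have c3 : count T A (fun W => u ∈ W) ≤ (2 ^ P.card : ℕ) *
        ((1.6740 : ℝ) ^ A.card * (1.6740⁻¹ : ℝ) ^ (P.card + 2)) := by
      rw [← card_powerset]
      exact count_le_card_mul (X := P) P.powerset
        (fun W _ _ => mem_powerset.2 inter_subset_right) c2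
    have c4 : count T A (fun _ => True) ≤ count T A (fun W => u ∉ W) +
        count T A (fun W => u ∈ W) := count_le_add fun W _ _ => (em _).symm
    have c5 : (1.6740⁻¹ : ℝ) ^ 2 + (2 ^ P.card : ℕ) * (1.6740⁻¹ : ℝ) ^ (P.card + 2) ≤ 1 := by
      interval_cases P.card <;> norm_num
    have hpos : (0 : ℝ) ≤ (1.6740 : ℝ) ^ A.card := by positivity
    nlinarith
  · have c3 := count_notMem_le hT hA hv
    have c4 : count T A (fun _ => True) ≤ count T A (fun W => v ∉ W) +
        count T A (fun W => v ∈ W) := count_le_add fun W _ _ => (em _).symm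
    have c5 : count T A (fun W => v ∈ W) ≤ count T A (fun W => u ∉ W) +
        count T A (fun W => u ∈ W ∧ W ∩ P = ∅) := by
      refine count_le_add fun W hW hvW => ?_
      by_cases huW : u ∈ W
      · refine Or.inr ⟨huW, eq_empty_of_forall_notMem fun w hw => ?_⟩
        rw [mem_inter, mem_inNbrs] at hw
        have hwv : w ≠ v := by rintro rfl; exact hT.asymm huv hw.2.2
        exact (mem_mts.1 hW).2.1 u huW v hvW w hw.1
          ⟨huv, hdom w hw.2.1 hwv (hT.ne hw.2.2), hw.2.2⟩
      · exact Or.inl huW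
    have c6 := c2 ∅ (empty_mem_powerset _)
    have c7 : (1.6740⁻¹ : ℝ) ^ (P.card + 2) ≤ (1.6740⁻¹ : ℝ) ^ 6 :=
      pow_le_pow_of_le_one (by norm_num) (by norm_num) (by omega)
    -- The tightest numerical inequality of the proof, with slack below 0.0004; it limits how far
    -- 1.6740 can be lowered.
    have c8 : (1.6740⁻¹ : ℝ) ^ 1 + (1.6740⁻¹ : ℝ) ^ 2 + (1.6740⁻¹ : ℝ) ^ 6 ≤ 1 := by norm_num
    have hpos : (0 : ℝ) ≤ (1.6740 : ℝ) ^ A.card := by positivity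
    nlinarith

/-! ### Minimum in-degree two -/

/-- A vertex `v` of `T[A]` with exactly two in-neighbours `a → b`. -/
structure InPair (T : Digraph V) (A : Finset V) (a b v : V) : Prop where
  tournament : IsTournament T
  bound : BoundBelow T A
  mem_a : a ∈ A
  mem_b : b ∈ A
  mem_v : v ∈ A
  ab : T.Adj a b
  av : T.Adj a v
  bv : T.Adj b v
  eq_or_eq : ∀ w ∈ A, T.Adj w v → w = a ∨ w = b

namespace InPair

variable {A : Finset V} {a b v : V}

theorem adj (H : InPair T A a b v) {w : V} (hw : w ∈ A) (hv : w ≠ v) (ha : w ≠ a) (hb : w ≠ b) :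
    T.Adj v w :=
  (H.tournament.total hv).resolve_left fun h => (H.eq_or_eq w hw h).elim ha hb

theorem subset_left (H : InPair T A a b v) :
    insert v (insert b (insert a (inNbrs T A a))) ⊆ A :=
  insert_subset H.mem_v (insert_subset H.mem_b (insert_subset H.mem_a inNbrs_subset))

theorem subset_right (H : InPair T A a b v) : insert v (insert b (inNbrs T A b)) ⊆ A :=
  insert_subset H.mem_v (insert_subset H.mem_b inNbrs_subset)

theorem card_left (H : InPair T A a b v) :
    (insert v (insert b (insert a (inNbrs T A a)))).card = (inNbrs T A a).card + 3 := by
  have hT := H.tournament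
  rw [card_insert_of_notMem, card_insert_of_notMem, card_insert_of_notMem]
  · exact fun h => hT.loopless _ (mem_inNbrs.1 h).2
  · simp only [mem_insert, mem_inNbrs, not_or]
    exact ⟨(hT.ne H.ab).symm, fun h => hT.asymm H.ab h.2⟩
  · simp only [mem_insert, mem_inNbrs, not_or]
    exact ⟨(hT.ne H.bv).symm, (hT.ne H.av).symm, fun h => hT.asymm H.av h.2⟩

theorem card_right (H : InPair T A a b v) :
    (insert v (insert b (inNbrs T A b))).card = (inNbrs T A b).card + 2 := by
  have hT := H.tournament
  rw [card_insert_of_notMem, card_insert_of_notMem]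
  · exact fun h => hT.loopless _ (mem_inNbrs.1 h).2
  · simp only [mem_insert, mem_inNbrs, not_or]
    exact ⟨(hT.ne H.bv).symm, fun h => hT.asymm H.bv h.2⟩

/-- Nothing in `W` beats `v`, so `v` is forced in as the source. -/
theorem count_avoid (H : InPair T A a b v) : count T A (fun W => a ∉ W ∧ b ∉ W) ≤
    (1.6740 : ℝ) ^ A.card * (1.6740⁻¹ : ℝ) ^ 3 := by
  have hT := H.tournament
  refine count_le hT H.bound {v} {v, b, a} 3 (by norm_num) ?_ ?_ fun W hW hp => ?_
  · exact insert_subset H.mem_v (insert_subset H.mem_b (singleton_subset_iff.2 H.mem_a))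
  · rw [card_eq_three.2 ⟨v, b, a, (hT.ne H.bv).symm, (hT.ne H.av).symm, (hT.ne H.ab).symm, rfl⟩]
  · have hWA := (mem_mts.1 hW).1
    refine ⟨singleton_subset_iff.2 ?_, fun w hw hwv => ?_⟩
    · by_contra hvW
      obtain ⟨y, hy, z, hz, -, -, hzv⟩ := exists_triangle_of_mem_mts hT hW H.mem_v hvW
      rcases H.eq_or_eq z (hWA hz) hzv with rfl | rfl
      · exact hp.1 hz
      · exact hp.2 hz
    · rw [mem_singleton] at hwv
      have hwa : w ≠ a := by rintro rfl; exact hp.1 hw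
      have hwb : w ≠ b := by rintro rfl; exact hp.2 hw
      simp [hwv, hwa, hwb, H.adj (hWA hw) hwv hwa hwb]

/-- An arc `w → a` would close the triangle `a → v → w → a`. So `a, v ∈ W` excludes all
in-neighbours of `a`. -/
theorem adj_left (H : InPair T A a b v) {W : Finset V} (hW : W ∈ mts T A) (ha : a ∈ W)
    (hv : v ∈ W) {w : V} (hw : w ∈ W) (hwa : w ≠ a) : T.Adj a w := by
  refine (H.tournament.total hwa).resolve_left fun h => ?_
  have hwv : w ≠ v := by rintro rfl; exact H.tournament.asymm H.av h
  have hwb : w ≠ b := by rintro rfl; exact H.tournament.asymm H.ab h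
  exact (mem_mts.1 hW).2.1 a ha v hv w hw
    ⟨H.av, H.adj ((mem_mts.1 hW).1 hw) hwv hwa hwb, h⟩

theorem adj_right (H : InPair T A a b v) {W : Finset V} (hW : W ∈ mts T A) (hb : b ∈ W)
    (hv : v ∈ W) {w : V} (hw : w ∈ W) (hwa : w ≠ a) (hwb : w ≠ b) : T.Adj b w := by
  refine (H.tournament.total hwb).resolve_left fun h => ?_
  have hwv : w ≠ v := by rintro rfl; exact H.tournament.asymm H.bv h
  exact (mem_mts.1 hW).2.1 b hb v hv w hw
    ⟨H.bv, H.adj ((mem_mts.1 hW).1 hw) hwv hwa hwb, h⟩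

theorem count_left (H : InPair T A a b v) : count T A (fun W => a ∈ W ∧ b ∉ W ∧ v ∈ W) ≤
    (1.6740 : ℝ) ^ A.card * (1.6740⁻¹ : ℝ) ^ ((inNbrs T A a).card + 3) := by
  have hT := H.tournament
  refine count_le hT H.bound {a, v} _ _ (Nat.succ_pos _) H.subset_left H.card_left.ge
    fun W hW hp => ⟨insert_subset hp.1 (singleton_subset_iff.2 hp.2.2), fun w hw hwD => ?_⟩
  simp only [mem_insert, mem_singleton, not_or] at hwD
  have hwb : w ≠ b := by rintro rfl; exact hp.2.1 hw
  have haw := H.adj_left hW hp.1 hp.2.2 hw hwD.1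
  have hwI : w ∉ inNbrs T A a := fun h => hT.asymm haw (mem_inNbrs.1 h).2
  simp [hwD, hwb, haw, hwI, H.adj ((mem_mts.1 hW).1 hw) hwD.2 hwD.1 hwb]

theorem count_right (H : InPair T A a b v) : count T A (fun W => a ∉ W ∧ b ∈ W ∧ v ∈ W) ≤
    (1.6740 : ℝ) ^ A.card * (1.6740⁻¹ : ℝ) ^ ((inNbrs T A b).card + 2) := by
  have hT := H.tournament
  refine count_le hT H.bound {b, v} _ _ (Nat.succ_pos _) H.subset_right H.card_right.ge
    fun W hW hp => ⟨insert_subset hp.2.1 (singleton_subset_iff.2 hp.2.2), fun w hw hwD => ?_⟩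
  simp only [mem_insert, mem_singleton, not_or] at hwD
  have hwa : w ≠ a := by rintro rfl; exact hp.1 hw
  have hbw := H.adj_right hW hp.2.1 hp.2.2 hw hwa hwD.1
  have hwI : w ∉ inNbrs T A b := fun h => hT.asymm hbw (mem_inNbrs.1 h).2
  simp [hwD, hbw, hwI, H.adj ((mem_mts.1 hW).1 hw) hwD.2 hwa hwD.1]

/-- Both in-neighbourhoods are avoided here; this bound and `count_both_right` use one each, and the
better one is chosen later. -/
theorem count_both_left (H : InPair T A a b v) :
    count T A (fun W => a ∈ W ∧ b ∈ W ∧ v ∈ W) ≤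
      (1.6740 : ℝ) ^ A.card * (1.6740⁻¹ : ℝ) ^ ((inNbrs T A a).card + 3) := by
  have hT := H.tournament
  refine count_le hT H.bound {a, b, v} _ _ (Nat.succ_pos _) H.subset_left H.card_left.ge
    fun W hW hp => ⟨insert_subset hp.1 (insert_subset hp.2.1 (singleton_subset_iff.2 hp.2.2)),
      fun w hw hwD => ?_⟩
  simp only [mem_insert, mem_singleton, not_or] at hwD
  have haw := H.adj_left hW hp.1 hp.2.2 hw hwD.1
  have hbw := H.adj_right hW hp.2.1 hp.2.2 hw hwD.1 hwD.2.1
  have hwI : w ∉ inNbrs T A a := fun h => hT.asymm haw (mem_inNbrs.1 h).2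
  simp [hwD, haw, hbw, hwI, H.adj ((mem_mts.1 hW).1 hw) hwD.2.2 hwD.1 hwD.2.1]

theorem count_both_right (H : InPair T A a b v) :
    count T A (fun W => a ∈ W ∧ b ∈ W ∧ v ∈ W) ≤
      (1.6740 : ℝ) ^ A.card * (1.6740⁻¹ : ℝ) ^ ((inNbrs T A b).card + 2) := by
  have hT := H.tournament
  refine count_le hT H.bound {a, b, v} _ _ (Nat.succ_pos _) H.subset_right H.card_right.ge
    fun W hW hp => ⟨insert_subset hp.1 (insert_subset hp.2.1 (singleton_subset_iff.2 hp.2.2)),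
      fun w hw hwD => ?_⟩
  simp only [mem_insert, mem_singleton, not_or] at hwD
  have haw := H.adj_left hW hp.1 hp.2.2 hw hwD.1
  have hbw := H.adj_right hW hp.2.1 hp.2.2 hw hwD.1 hwD.2.1
  have hwI : w ∉ inNbrs T A b := fun h => hT.asymm hbw (mem_inNbrs.1 h).2
  simp [hwD, haw, hbw, hwI, H.adj ((mem_mts.1 hW).1 hw) hwD.2.2 hwD.1 hwD.2.1]

theorem mem_right (H : InPair T A a b v) : a ∈ inNbrs T A b := mem_inNbrs.2 ⟨H.mem_a, H.ab⟩

/-- The trace on the in-neighbours of `b` omits `a`, which halves the number of traces. An empty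
trace forces `v` in; a nonempty one contains some `s ≠ a`, beaten by `v`. Either way `v` is deleted.
-/
theorem count_only_right (H : InPair T A a b v) : count T A (fun W => a ∉ W ∧ b ∈ W) ≤
    (2 ^ ((inNbrs T A b).card - 1) : ℕ) *
      ((1.6740 : ℝ) ^ A.card * (1.6740⁻¹ : ℝ) ^ ((inNbrs T A b).card + 2)) := by
  have hT := H.tournament
  rw [← card_erase_of_mem H.mem_right, ← card_powerset]
  refine count_le_card_mul (X := inNbrs T A b) _ (fun W hW hp => ?_) (fun S hS => ?_)
  · rw [mem_powerset]
    refine fun w hw => mem_erase.2 ⟨?_, (mem_inter.1 hw).2⟩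
    rintro rfl
    exact hp.1 (mem_inter.1 hw).1
  · rcases S.eq_empty_or_nonempty with rfl | ⟨s, hs⟩
    · refine (count_mono fun W hW hp => ⟨hp.1.1, hp.1.2, ?_⟩).trans H.count_right
      have hWA := (mem_mts.1 hW).1
      refine mem_mts_of_inter_eq_empty hT hW H.mem_v (u := b) (fun w hw hwv => ?_)
        (fun w hw hwb => mem_inNbrs.2 ⟨hWA hw, hwb⟩) hp.2
      refine (H.eq_or_eq w (hWA hw) hwv).resolve_left ?_
      rintro rfl
      exact hp.1.1 hw
    · refine count_trace_le hT H.bound (u := b) S _ _ (Nat.succ_pos _) H.subset_right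
        H.card_right.ge fun W hW hp => ⟨hp.1.2, hp.2, fun w hw hbw hsw hwC => ?_⟩
      have hs' := mem_erase.1 (mem_powerset.1 hS hs)
      have hs'' := mem_inNbrs.1 hs'.2
      rcases mem_insert.1 hwC with rfl | hwC
      · rcases H.eq_or_eq s hs''.1 (hsw s hs) with rfl | rfl
        · exact hs'.1 rfl
        · exact hT.loopless _ hs''.2
      · rcases mem_insert.1 hwC with rfl | hwC
        · exact hT.loopless _ hbw
        · exact hT.asymm hbw (mem_inNbrs.1 hwC).2

/-- Members of the trace differ from `a` and `b`, so `v` beats them and drops out. As they all beat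
`b`, it may survive. -/
theorem count_trace_subset (H : InPair T A a b v) :
    count T A (fun W => a ∈ W ∧ W ∩ inNbrs T A a ≠ ∅ ∧ W ∩ inNbrs T A a ⊆ inNbrs T A b) ≤
      (2 ^ (inNbrs T A a ∩ inNbrs T A b).card - 1 : ℕ) *
        ((1.6740 : ℝ) ^ A.card * (1.6740⁻¹ : ℝ) ^ ((inNbrs T A a).card + 2)) := by
  have hT := H.tournament
  rw [← card_powerset, ← card_erase_of_mem (empty_mem_powerset _)]
  refine count_le_card_mul (X := inNbrs T A a) _ (fun W hW hp => ?_) (fun S hS => ?_)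
  · exact mem_erase.2 ⟨hp.2.1, mem_powerset.2 (subset_inter inter_subset_right hp.2.2)⟩
  · obtain ⟨s, hs⟩ := nonempty_iff_ne_empty.2 (mem_erase.1 hS).1
    have hs' := mem_inNbrs.1 (mem_inter.1 (mem_powerset.1 (mem_erase.1 hS).2 hs)).1
    have hvI : v ∉ insert a (inNbrs T A a) := by
      simp only [mem_insert, mem_inNbrs, not_or]
      exact ⟨(hT.ne H.av).symm, fun h => hT.asymm H.av h.2⟩
    refine count_trace_le hT H.bound (u := a) S (insert v (insert a (inNbrs T A a))) _
      (Nat.succ_pos _)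
      (insert_subset H.mem_v (insert_subset H.mem_a inNbrs_subset)) ?_
      fun W hW hp => ⟨hp.1.1, hp.2, fun w hw haw hsw hwC => ?_⟩
    · rw [card_insert_of_notMem hvI, card_insert_of_notMem]
      exact fun h => hT.loopless _ (mem_inNbrs.1 h).2
    · rcases mem_insert.1 hwC with rfl | hwC
      · rcases H.eq_or_eq s hs'.1 (hsw s hs) with rfl | rfl
        · exact hT.loopless _ hs'.2
        · exact hT.asymm H.ab hs'.2
      · rcases mem_insert.1 hwC with rfl | hwC
        · exact hT.loopless _ haw
        · exact hT.asymm haw (mem_inNbrs.1 hwC).2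

/-- Some `s` in the trace fails to beat `b`, so `b` drops out along with `v`, a gain of one in the
exponent. -/
theorem count_trace_not_subset (H : InPair T A a b v) :
    count T A (fun W => a ∈ W ∧ ¬ W ∩ inNbrs T A a ⊆ inNbrs T A b) ≤
      (2 ^ (inNbrs T A a).card - 2 ^ (inNbrs T A a ∩ inNbrs T A b).card : ℕ) *
        ((1.6740 : ℝ) ^ A.card * (1.6740⁻¹ : ℝ) ^ ((inNbrs T A a).card + 3)) := by
  have hT := H.tournament
  rw [← card_powerset, ← card_powerset,
    ← card_sdiff_of_subset (powerset_mono.2 inter_subset_left)]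
  refine count_le_card_mul (X := inNbrs T A a) _ (fun W hW hp => ?_) (fun S hS => ?_)
  · rw [mem_sdiff, mem_powerset, mem_powerset]
    exact ⟨inter_subset_right, fun h => hp.2 (h.trans inter_subset_right)⟩
  · rw [mem_sdiff, mem_powerset, mem_powerset] at hS
    have hSb : ¬ S ⊆ inNbrs T A b := fun h => hS.2 (subset_inter hS.1 h)
    obtain ⟨s, hs, hsb⟩ := not_subset.1 hSb
    have hs' := mem_inNbrs.1 (hS.1 hs)
    refine count_trace_le hT H.bound (u := a) S _ _ (Nat.succ_pos _) H.subset_left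
      H.card_left.ge fun W hW hp => ⟨hp.1.1, hp.2, fun w hw haw hsw hwC => ?_⟩
    rcases mem_insert.1 hwC with rfl | hwC
    · rcases H.eq_or_eq s hs'.1 (hsw s hs) with rfl | rfl
      · exact hT.loopless _ hs'.2
      · exact hT.asymm H.ab hs'.2
    · rcases mem_insert.1 hwC with rfl | hwC
      · exact hsb (mem_inNbrs.2 ⟨hs'.1, hsw s hs⟩)
      · rcases mem_insert.1 hwC with rfl | hwC
        · exact hT.loopless _ haw
        · exact hT.asymm haw (mem_inNbrs.1 hwC).2

theorem count_source (H : InPair T A a b v) :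
    count T A (fun W => a ∈ W ∧ W ∩ inNbrs T A a = ∅) ≤
      (1.6740 : ℝ) ^ A.card * (1.6740⁻¹ : ℝ) ^ ((inNbrs T A a).card + 1) := by
  have hT := H.tournament
  refine count_trace_le hT H.bound (u := a) ∅ (insert a (inNbrs T A a)) _ (Nat.succ_pos _)
    (insert_subset H.mem_a inNbrs_subset) ?_
    fun W hW hp => ⟨hp.1, hp.2, fun w hw haw hsw hwC => ?_⟩
  · rw [card_insert_of_notMem]
    exact fun h => hT.loopless _ (mem_inNbrs.1 h).2
  · rcases mem_insert.1 hwC with rfl | hwC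
    · exact hT.loopless _ haw
    · exact hT.asymm haw (mem_inNbrs.1 hwC).2

/-- If `a` is the source of `W` and `v ∉ W`, then `v` is blocked by a second in-neighbour of `b`. -/
theorem exists_block (H : InPair T A a b v) {W : Finset V} (hW : W ∈ mts T A)
    (hs : W ∩ inNbrs T A a = ∅) (hv : v ∉ W) :
    b ∈ W ∧ ∃ y ∈ W, y ∈ (inNbrs T A b).erase a \ inNbrs T A a := by
  have hWA := (mem_mts.1 hW).1
  have hno : ∀ y ∈ W, y ∉ inNbrs T A a := fun y hy h => by
    have := mem_inter.2 ⟨hy, h⟩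
    simp [hs] at this
  obtain ⟨y, hy, z, hz, hvy, hyz, hzv⟩ :=
    exists_triangle_of_mem_mts H.tournament hW H.mem_v hv
  rcases H.eq_or_eq z (hWA hz) hzv with rfl | rfl
  · exact absurd (mem_inNbrs.2 ⟨hWA hy, hyz⟩) (hno y hy)
  · refine ⟨hz, y, hy, mem_sdiff.2 ⟨mem_erase.2 ⟨?_, mem_inNbrs.2 ⟨hWA hy, hyz⟩⟩, hno y hy⟩⟩
    rintro rfl
    exact H.tournament.asymm H.av hvy

/-- Apart from `a`, no in-neighbour of `b` is in `W`; so `b` is forced in, and then nothing blocks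
`v`. -/
theorem count_source_of_subset (H : InPair T A a b v)
    (hsub : (inNbrs T A b).erase a ⊆ inNbrs T A a) :
    count T A (fun W => a ∈ W ∧ W ∩ inNbrs T A a = ∅) ≤
      (1.6740 : ℝ) ^ A.card * (1.6740⁻¹ : ℝ) ^ ((inNbrs T A a).card + 3) := by
  refine (count_mono fun W hW hp => ⟨hp.1, ?_, ?_⟩).trans H.count_both_left
  · have hWA := (mem_mts.1 hW).1
    refine mem_mts_of_inter_eq_empty H.tournament hW H.mem_b (u := a) (fun w hw hwb => ?_)
      (fun w hw hwa => mem_inNbrs.2 ⟨hWA hw, hwa⟩) hp.2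
    by_contra hwa
    have := mem_inter.2 ⟨hw, hsub (mem_erase.2 ⟨hwa, mem_inNbrs.2 ⟨hWA hw, hwb⟩⟩)⟩
    simp [hp.2] at this
  · by_contra hv
    obtain ⟨-, y, -, hy⟩ := H.exists_block hW hp.2 hv
    rw [mem_sdiff] at hy
    exact hy.2 (hsub hy.1)

/-- A single vertex `y` can block `v`. If it does, `W` starts with `a → y → b` and `y` is one more
deleted vertex; otherwise `v ∈ W`, with or without `b`. -/
theorem count_source_of_card_sdiff_eq_one (H : InPair T A a b v)
    (h : ((inNbrs T A b).erase a \ inNbrs T A a).card = 1) :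
    count T A (fun W => a ∈ W ∧ W ∩ inNbrs T A a = ∅) ≤
      (1.6740 : ℝ) ^ A.card * (1.6740⁻¹ : ℝ) ^ ((inNbrs T A a).card + 3) +
      ((1.6740 : ℝ) ^ A.card * (1.6740⁻¹ : ℝ) ^ ((inNbrs T A a).card + 3) +
       (1.6740 : ℝ) ^ A.card * (1.6740⁻¹ : ℝ) ^ ((inNbrs T A a).card + 4)) := by
  have hT := H.tournament
  obtain ⟨y, hy⟩ := card_eq_one.1 h
  have hyy : y ∈ (inNbrs T A b).erase a \ inNbrs T A a := by simp [hy]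
  obtain ⟨hy1, hyI⟩ := mem_sdiff.1 hyy
  obtain ⟨hya, hy2⟩ := mem_erase.1 hy1
  obtain ⟨hyA, hyb⟩ := mem_inNbrs.1 hy2
  have hyC : y ∉ insert v (insert b (insert a (inNbrs T A a))) := by
    simp only [mem_insert, not_or]
    refine ⟨?_, hT.ne hyb, hya, hyI⟩
    rintro rfl
    exact hT.asymm H.bv hyb
  have last : count T A (fun W => (a ∈ W ∧ W ∩ inNbrs T A a = ∅) ∧ v ∉ W) ≤
      (1.6740 : ℝ) ^ A.card * (1.6740⁻¹ : ℝ) ^ ((inNbrs T A a).card + 4) := by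
    refine count_le hT H.bound {a, b, y} _ _ (Nat.succ_pos _) (insert_subset hyA H.subset_left)
      (by rw [card_insert_of_notMem hyC, H.card_left]) fun W hW hp => ?_
    have hWA := (mem_mts.1 hW).1
    obtain ⟨hbW, y', hyW, hy'⟩ := H.exists_block hW hp.1.2 hp.2
    rw [hy, mem_singleton] at hy'
    subst hy'
    refine ⟨insert_subset hp.1.1 (insert_subset hbW (singleton_subset_iff.2 hyW)),
      fun w hw hwD => ?_⟩
    simp only [mem_insert, mem_singleton, not_or] at hwD
    have hwI : w ∉ inNbrs T A a := fun h => by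
      have := mem_inter.2 ⟨hw, h⟩
      simp [hp.1.2] at this
    have haw : T.Adj a w := (hT.total hwD.1).resolve_left fun h => hwI (mem_inNbrs.2 ⟨hWA hw, h⟩)
    have hbw : T.Adj b w := (hT.total hwD.2.1).resolve_left fun h => by
      have : w ∈ (inNbrs T A b).erase a \ inNbrs T A a :=
        mem_sdiff.2 ⟨mem_erase.2 ⟨hwD.1, mem_inNbrs.2 ⟨hWA hw, h⟩⟩, hwI⟩
      rw [hy, mem_singleton] at this
      exact hwD.2.2 this
    have hyw : T.Adj y' w := (hT.total hwD.2.2).resolve_left fun h =>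
      (mem_mts.1 hW).2.1 y' hyW b hbW w hw ⟨hyb, hbw, h⟩
    have hwv : w ≠ v := by rintro rfl; exact hp.2 hw
    simp [hwD, haw, hbw, hyw, hwI, hwv]
  refine (count_le_add (q := fun W => a ∈ W ∧ b ∉ W ∧ v ∈ W) (r := fun W =>
    (a ∈ W ∧ b ∈ W ∧ v ∈ W) ∨ ((a ∈ W ∧ W ∩ inNbrs T A a = ∅) ∧ v ∉ W)) ?_).trans
    (add_le_add H.count_left ((count_le_add fun W _ h => h).trans
      (add_le_add H.count_both_left last)))
  intro W _ hp
  tauto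

/-- Splitting on `v` first avoids enumerating traces, which pays when the in-degrees of `a` and `b`
are large. -/
theorem card_mts_le_of_large (H : InPair T A a b v) :
    ((mts T A).card : ℝ) ≤ (1.6740 : ℝ) ^ A.card * (1.6740⁻¹ : ℝ) ^ 1 +
      ((1.6740 : ℝ) ^ A.card * (1.6740⁻¹ : ℝ) ^ 3 +
      ((1.6740 : ℝ) ^ A.card * (1.6740⁻¹ : ℝ) ^ ((inNbrs T A a).card + 3) +
      ((1.6740 : ℝ) ^ A.card * (1.6740⁻¹ : ℝ) ^ ((inNbrs T A b).card + 2) +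
        count T A (fun W => a ∈ W ∧ b ∈ W ∧ v ∈ W)))) := by
  rw [← count_true]
  refine (count_le_add (q := fun W => v ∉ W) (r := fun W => v ∈ W) fun W _ _ =>
    (em _).symm).trans (add_le_add (count_notMem_le H.tournament H.bound H.mem_v) ?_)
  refine (count_le_add (r := fun W => v ∈ W ∧ (a ∈ W ∨ b ∈ W)) ?_).trans
    (add_le_add H.count_avoid ?_)
  · intro W _ hp; tauto
  refine (count_le_add (r := fun W => b ∈ W ∧ v ∈ W) ?_).trans
    (add_le_add H.count_left ?_)
  · intro W _ hp; tauto
  refine (count_le_add ?_).trans (add_le_add_left H.count_right _)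
  intro W _ hp; tauto

/-- Here `v` itself is not tested; the traces are enumerated, which is affordable for small
in-degrees. -/
theorem card_mts_le_of_small (H : InPair T A a b v) :
    ((mts T A).card : ℝ) ≤ (1.6740 : ℝ) ^ A.card * (1.6740⁻¹ : ℝ) ^ 3 +
      ((2 ^ ((inNbrs T A b).card - 1) : ℕ) *
        ((1.6740 : ℝ) ^ A.card * (1.6740⁻¹ : ℝ) ^ ((inNbrs T A b).card + 2)) +
      ((2 ^ (inNbrs T A a ∩ inNbrs T A b).card - 1 : ℕ) *
        ((1.6740 : ℝ) ^ A.card * (1.6740⁻¹ : ℝ) ^ ((inNbrs T A a).card + 2)) +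
      ((2 ^ (inNbrs T A a).card - 2 ^ (inNbrs T A a ∩ inNbrs T A b).card : ℕ) *
        ((1.6740 : ℝ) ^ A.card * (1.6740⁻¹ : ℝ) ^ ((inNbrs T A a).card + 3)) +
      count T A (fun W => a ∈ W ∧ W ∩ inNbrs T A a = ∅)))) := by
  rw [← count_true]
  refine (count_le_add (r := fun W => a ∈ W ∨ b ∈ W) ?_).trans
    (add_le_add H.count_avoid ?_)
  · intro W _ hp; tauto
  refine (count_le_add (r := fun W => a ∈ W) ?_).trans (add_le_add H.count_only_right ?_)
  · intro W _ hp; tauto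
  refine (count_le_add (r := fun W => (a ∈ W ∧ ¬ W ∩ inNbrs T A a ⊆ inNbrs T A b) ∨
    (a ∈ W ∧ W ∩ inNbrs T A a = ∅)) ?_).trans (add_le_add H.count_trace_subset ?_)
  · intro W _ hp; tauto
  exact (count_le_add fun W _ hp => hp).trans (add_le_add_left H.count_trace_not_subset _)

theorem card_mts_le (H : InPair T A a b v) (ha : 2 ≤ (inNbrs T A a).card)
    (hb : 2 ≤ (inNbrs T A b).card) : ((mts T A).card : ℝ) ≤ (1.6740 : ℝ) ^ A.card := by
  have hpos : (0 : ℝ) ≤ (1.6740 : ℝ) ^ A.card := by positivity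
  have large := H.card_mts_le_of_large
  have small := H.card_mts_le_of_small
  have mono : ∀ i j : ℕ, i ≤ j → (1.6740 : ℝ) ^ A.card * (1.6740⁻¹ : ℝ) ^ j ≤
      (1.6740 : ℝ) ^ A.card * (1.6740⁻¹ : ℝ) ^ i := fun i j hij =>
    mul_le_mul_of_nonneg_left (pow_le_pow_of_le_one (by norm_num) (by norm_num) hij) hpos
  have hcard : ((inNbrs T A b).erase a \ inNbrs T A a).card +
      (inNbrs T A a ∩ inNbrs T A b).card + 1 = (inNbrs T A b).card := by
    have haa : a ∉ inNbrs T A a := fun h => H.tournament.loopless _ (mem_inNbrs.1 h).2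
    have h1 := card_sdiff_add_card_inter ((inNbrs T A b).erase a) (inNbrs T A a)
    have h2 : (inNbrs T A b).erase a ∩ inNbrs T A a = inNbrs T A a ∩ inNbrs T A b := by
      ext w
      simp only [mem_inter, mem_erase]
      constructor
      · tauto
      · rintro ⟨h, h'⟩
        refine ⟨⟨?_, h'⟩, h⟩
        rintro rfl
        exact haa h
    have h3 := card_erase_add_one H.mem_right
    rw [h2] at h1
    omega
  have bl := H.count_both_left
  have br := H.count_both_right
  have src := H.count_source
  by_cases h33 : 3 ≤ (inNbrs T A a).card ∧ 3 ≤ (inNbrs T A b).card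
  · have m1 := mono 6 _ (show 6 ≤ (inNbrs T A a).card + 3 by omega)
    have m2 := mono 5 _ (show 5 ≤ (inNbrs T A b).card + 2 by omega)
    have num : (1.6740⁻¹ : ℝ) ^ 1 + 1.6740⁻¹ ^ 3 + 1.6740⁻¹ ^ 6 + 1.6740⁻¹ ^ 5 + 1.6740⁻¹ ^ 6
      ≤ 1 := by norm_num
    nlinarith
  by_cases h4 : 4 ≤ (inNbrs T A b).card
  · have m1 := mono 5 _ (show 5 ≤ (inNbrs T A a).card + 3 by omega)
    have m2 := mono 6 _ (show 6 ≤ (inNbrs T A b).card + 2 by omega)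
    have num : (1.6740⁻¹ : ℝ) ^ 1 + 1.6740⁻¹ ^ 3 + 1.6740⁻¹ ^ 5 + 1.6740⁻¹ ^ 6 + 1.6740⁻¹ ^ 6
      ≤ 1 := by norm_num
    nlinarith
  by_cases h4' : 4 ≤ (inNbrs T A a).card
  · have m1 := mono 7 _ (show 7 ≤ (inNbrs T A a).card + 3 by omega)
    have m2 := mono 4 _ (show 4 ≤ (inNbrs T A b).card + 2 by omega)
    have num : (1.6740⁻¹ : ℝ) ^ 1 + 1.6740⁻¹ ^ 3 + 1.6740⁻¹ ^ 7 + 1.6740⁻¹ ^ 4 + 1.6740⁻¹ ^ 7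
      ≤ 1 := by norm_num
    nlinarith
  -- The in-degrees of `(a, b)` left are (2, 2), (3, 2) and (2, 3).
  by_cases h2 : (inNbrs T A b).card = 2
  · clear large bl br mono
    have hj : (inNbrs T A a ∩ inNbrs T A b).card ≤ 1 := by omega
    have ha' : (inNbrs T A a).card ≤ 3 := by omega
    rw [h2] at small
    generalize (inNbrs T A a ∩ inNbrs T A b).card = j at *
    generalize (inNbrs T A a).card = i at *
    refine small.trans ((add_le_add_right (add_le_add_right (add_le_add_right
      (add_le_add_right src _) _) _) _).trans ?_)
    simp only [mul_left_comm _ ((1.6740 : ℝ) ^ A.card), ← mul_add]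
    refine mul_le_of_le_one_right hpos ?_
    interval_cases i <;> interval_cases j <;> norm_num
  · have h3 : (inNbrs T A b).card = 3 := by omega
    have ha2 : (inNbrs T A a).card = 2 := by omega
    have hj : (inNbrs T A a ∩ inNbrs T A b).card ≤ 2 := by omega
    -- For (2, 3), `count_source` suffices only without common in-neighbours; with one or two the
    -- sum would exceed 1, hence the refined bounds.
    have src1 : (inNbrs T A a ∩ inNbrs T A b).card = 1 → _ := fun h =>
      H.count_source_of_card_sdiff_eq_one (by omega)
    have src2 : (inNbrs T A a ∩ inNbrs T A b).card = 2 → _ := fun h =>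
      H.count_source_of_subset (sdiff_eq_empty_iff_subset.1 (card_eq_zero.1
        (show ((inNbrs T A b).erase a \ inNbrs T A a).card = 0 by omega)))
    rw [h3, ha2] at small
    rw [ha2] at src src1 src2
    clear large bl br mono
    generalize (inNbrs T A a ∩ inNbrs T A b).card = j at *
    have hj' : j = 0 ∨ j = 1 ∨ j = 2 := by omega
    rcases hj' with rfl | rfl | rfl
    · refine small.trans ((add_le_add_right (add_le_add_right (add_le_add_right
        (add_le_add_right src _) _) _) _).trans ?_)
      simp only [mul_left_comm _ ((1.6740 : ℝ) ^ A.card), ← mul_add]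
      exact mul_le_of_le_one_right hpos (by norm_num)
    · refine small.trans ((add_le_add_right (add_le_add_right (add_le_add_right
        (add_le_add_right (src1 rfl) _) _) _) _).trans ?_)
      simp only [mul_left_comm _ ((1.6740 : ℝ) ^ A.card), ← mul_add]
      exact mul_le_of_le_one_right hpos (by norm_num)
    · refine small.trans ((add_le_add_right (add_le_add_right (add_le_add_right
        (add_le_add_right (src2 rfl) _) _) _) _).trans ?_)
      simp only [mul_left_comm _ ((1.6740 : ℝ) ^ A.card), ← mul_add]
      exact mul_le_of_le_one_right hpos (by norm_num)

end InPair

/-! ### The induction -/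

theorem card_mts_le (hT : IsTournament T) (A : Finset V) :
    ((mts T A).card : ℝ) ≤ (1.6740 : ℝ) ^ A.card := by
  induction A using Finset.strongInduction with
  | H A ih =>
    have hA : BoundBelow T A := ih
    rcases A.eq_empty_or_nonempty with rfl | hne
    · have h : (mts T ∅).card ≤ 1 := card_filter_le _ _
      simpa using h
    obtain ⟨v, hv, hmin⟩ := exists_min_image A (fun v => (inNbrs T A v).card) hne
    rcases lt_or_ge (inNbrs T A v).card 3 with h3 | h3
    · have hcases : (inNbrs T A v).card = 0 ∨ (inNbrs T A v).card = 1 ∨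
          (inNbrs T A v).card = 2 := by omega
      rcases hcases with h | h | h
      · exact card_mts_le_of_inNbrs_eq_empty hT hA hv (card_eq_zero.1 h)
      · obtain ⟨u, hu⟩ := card_eq_one.1 h
        refine card_mts_le_of_inNbrs_eq_singleton hT hA hv hu (h ▸ hmin u ?_)
        exact inNbrs_subset (v := v) (by simp [hu] : u ∈ inNbrs T A v)
      · obtain ⟨a, b, hab, hI⟩ := card_eq_two.1 h
        have ha := mem_inNbrs.1 (by simp [hI] : a ∈ inNbrs T A v)
        have hb := mem_inNbrs.1 (by simp [hI] : b ∈ inNbrs T A v)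
        have hor : ∀ w ∈ A, T.Adj w v → w = a ∨ w = b := fun w hw hwv => by
          simpa [hI] using mem_inNbrs.2 ⟨hw, hwv⟩
        rcases hT.total hab with h' | h'
        · exact InPair.card_mts_le ⟨hT, hA, ha.1, hb.1, hv, h', ha.2, hb.2, hor⟩
            (h ▸ hmin a ha.1) (h ▸ hmin b hb.1)
        · exact InPair.card_mts_le ⟨hT, hA, hb.1, ha.1, hv, h', hb.2, ha.2,
            fun w hw hwv => (hor w hw hwv).symm⟩ (h ▸ hmin b hb.1) (h ▸ hmin a ha.1)
    · exact card_mts_le_of_three_le hT hA hne fun w hw => h3.trans (hmin w hw)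

/-! ### Passage to sets and feedback vertex sets -/

theorem isTransitive_induced_iff (hT : IsTournament T) (W : Finset V) :
    IsTransitive (induced T (W : Set V)) ↔ NoTriangle T W := by
  constructor
  · intro h x hx y hy z hz hc
    exact hT.asymm hc.2.2 (h ⟨x, hx⟩ ⟨y, hy⟩ ⟨z, hz⟩ hc.1 hc.2.1)
  · rintro h ⟨x, hx⟩ ⟨y, hy⟩ ⟨z, hz⟩ hxy hyz
    have hxy' : T.Adj x y := hxy
    have hyz' : T.Adj y z := hyz
    have hne : x ≠ z := by rintro rfl; exact hT.asymm hxy' hyz'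
    exact (hT.total hne).resolve_right fun hzx => h x hx y hy z hz ⟨hxy', hyz', hzx⟩

theorem mem_mts_univ_of_isMaximalTransitive [Fintype V] (hT : IsTournament T) {W : Finset V}
    (h : IsMaximalTransitive T (W : Set V)) : W ∈ mts T univ := by
  refine mem_mts.2 ⟨subset_univ _, (isTransitive_induced_iff hT W).1 h.1, fun x _ hx hno => ?_⟩
  have h1 := (isTransitive_induced_iff hT _).2 hno
  have h2 := h.2 h1 (coe_subset.2 (subset_insert x W))
  exact hx (mem_coe.1 (h2 (mem_coe.2 (mem_insert_self x W))))

theorem numMaximalTransitive_le [Finite V] (hT : IsTournament T) :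
    (numMaximalTransitive T : ℝ) ≤ (1.6740 : ℝ) ^ Nat.card V := by
  have := Fintype.ofFinite V
  have h1 : numMaximalTransitive T ≤ (mts T univ).card := by
    rw [← Set.ncard_coe_finset, ← Set.ncard_image_of_injective _ (coe_injective (α := V))]
    refine Set.ncard_le_ncard (fun W hW => ?_) (Set.toFinite _)
    have hW' : IsMaximalTransitive T (W.toFinset : Set V) := by rwa [Set.coe_toFinset]
    exact ⟨W.toFinset, mem_mts_univ_of_isMaximalTransitive hT hW', Set.coe_toFinset W⟩
  have h2 := card_mts_le hT (univ : Finset V)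
  rw [card_univ, ← Nat.card_eq_fintype_card] at h2
  exact (Nat.cast_le.2 h1).trans h2

theorem numMinimalFVS_eq (hT : IsTournament T) : numMinimalFVS T = numMaximalTransitive T := by
  unfold numMinimalFVS numMaximalTransitive
  rw [← Set.ncard_image_of_injective {W : Set V | IsMaximalTransitive T W} compl_injective]
  congr 1
  ext F
  constructor
  · intro h
    refine ⟨Fᶜ, (hT.isMinimalFVS_compl_iff _).1 ?_, compl_compl F⟩
    rwa [compl_compl]
  · rintro ⟨W, hW, rfl⟩
    exact (hT.isMinimalFVS_compl_iff W).2 hW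

end TournamentFVS

theorem mainTheorem1 :
    (∀ (V : Type*) [Finite V] (T : Digraph V),
      TournamentFVS.IsTournament T → TournamentFVS.IsStrong T →
        (TournamentFVS.numMaximalTransitive T : ℝ) ≤ (1.6740 : ℝ) ^ Nat.card V) ∧
    (∀ (V : Type*) [Finite V] (T : Digraph V),
      TournamentFVS.IsTournament T →
        (TournamentFVS.numMinimalFVS T : ℝ) ≤ (1.6740 : ℝ) ^ Nat.card V) ∧
    (∀ n : ℕ, (TournamentFVS.maxNumMinimalFVS n : ℝ) ≤ (1.6740 : ℝ) ^ n) := by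
  refine ⟨fun V _ T hT _ => TournamentFVS.numMaximalTransitive_le hT, fun V _ T hT => ?_,
    fun n => ?_⟩
  · rw [TournamentFVS.numMinimalFVS_eq hT]
    exact TournamentFVS.numMaximalTransitive_le hT
  · obtain ⟨T, hT, h⟩ := (TournamentFVS.maxNumMinimalFVS_isGreatest n).1
    rw [← h, TournamentFVS.numMinimalFVS_eq hT]
    simpa using TournamentFVS.numMaximalTransitive_le hT
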